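/- Fix the standard orthonormal basis of $\mathcal H_d=\mathbb C^d$, and let $L(\mathcal H)$ denote the linear operators on a finite-dimensional Hilbert space $\mathcal H$ and $|X|=\sqrt{X^\dagger X}$. For a linear map $\Phi: L(\mathcal H)\to L(\mathcal H)$ let $$\|\Phi\|_\diamond=\sup_{k\ge 1}\ \sup_{X\in L(\mathcal H\otimes\mathbb C^k),\ \|X\|_1\le 1}\|(\Phi\otimes \mathrm{id}_{L(\mathbb C^k)})(X)\|_1,\qquad \|X\|_1=\mathrm{Tr}|X|,$$ be its diamond norm. Let $\mathbf U(\mathcal H)$ be the set of unitary channels $X\mapsto UXU^\dagger$ ($U$ unitary on $\mathcal H$), $\mathrm{Conv}(\mathbf U(\mathcal H))$ its convex hull, and $$D(\Phi,\mathrm{Conv}(\mathbf U(\mathcal H)))=\inf\{\|\Phi-\Psi\|_\diamond:\Psi\in \mathrm{Conv}(\mathbf U(\mathcal H))\}.$$ A Schur channel on $L(\mathcal H_d)$ is a map $\Phi(X)=S\circ X$ (entrywise product), where $S=[s_{kj}]$ is a positive semidefinite $d\times d$ matrix with $s_{kk}=1$ for all $k$. The Kraus space of a completely positive map $\Phi=\sum_k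 E_k\cdot E_k^\dagger$ is $K(\Phi)=\mathrm{span}\{E_k\}$ (it does not depend on the choice of the Kraus operators $E_k$). **Corollary.** Let $\Phi$ be a Schur channel on $L(\mathcal H_d)$ such that $K(\Phi)$ contains no unitary operator. Then the minimum $$C_\Phi=\min_{L\in K(\Phi)}\frac{\mathrm{Tr}\,(|L|-I_d)^2}{d}$$ is attained, and $$D(\Phi^{\otimes n},\mathrm{Conv}(\mathbf U(\mathcal H_d^{\otimes n})))\ \ge\ C_\Phi>0\qquad\text{for all } n\ge 1.$$ Consequently $\Phi$ is a counterexample to the asymptotic quantum Birkhoff conjecture: $\Phi$ is a unital quantum channel (completely positive, trace-preserving, $\Phi(I)=I$), and $D(\Phi^{\otimes n},\mathrm{Conv}(\mathbf U(\mathcal H_d^{\otimes n})))$ does not tend to $0$ as $n\to\infty$. -/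

import Mathlib

noncomputable section

namespace SchurAQBC

/-- The operators `L(ℂᵐ)`, written as matrices in a fixed orthonormal basis indexed by `m`. -/
abbrev Op (m : Type) : Type := Matrix m m ℂ

/-- Super-operators from `L(ℂᵐ)` to itself. -/
abbrev SuperOp (m : Type) : Type := Op m →ₗ[ℂ] Op m

section Basic

open scoped ComplexOrder

variable {m : Type} [Fintype m] [DecidableEq m]

open scoped MatrixOrder in
/-- The absolute value `|X| = √(Xᴴ X)` of an operator. -/
def absOp (X : Op m) : Op m := CFC.abs X

/-- The trace norm `‖X‖₁ = Tr |X|` (a nonnegative real number). -/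
def traceNorm (X : Op m) : ℝ := (absOp X).trace.re

/-- The ampliation `Φ ⊗ id` on `L(ℂᵐ ⊗ ℂᵏ)`: `Φ` is applied to each of the `k × k` blocks. -/
def ampliate (Φ : SuperOp m) (k : ℕ) : SuperOp (m × Fin k) where
  toFun X := Matrix.of fun a b => Φ (Matrix.of fun i j => X (i, a.2) (j, b.2)) a.1 b.1
  map_add' X Y := by
    ext a b
    have h : (Matrix.of fun i j => (X + Y) (i, a.2) (j, b.2) : Op m)
        = (Matrix.of fun i j => X (i, a.2) (j, b.2))
          + (Matrix.of fun i j => Y (i, a.2) (j, b.2)) := rfl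
    simp only [Matrix.of_apply, Matrix.add_apply]
    rw [← Matrix.add_apply, ← map_add, ← h]
    rfl
  map_smul' c X := by
    ext a b
    have h : (Matrix.of fun i j => (c • X) (i, a.2) (j, b.2) : Op m)
        = c • (Matrix.of fun i j => X (i, a.2) (j, b.2)) := rfl
    simp only [Matrix.of_apply, Matrix.smul_apply, RingHom.id_apply]
    rw [← Matrix.smul_apply, ← map_smul, ← h]
    rfl

/-- The induced trace norm `‖Φ‖₁ = sup { ‖Φ(X)‖₁ : ‖X‖₁ ≤ 1 }` of a super-operator. -/
def superTraceNorm (Φ : SuperOp m) : ENNReal :=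
  ⨆ X : {X : Op m // traceNorm X ≤ 1}, ENNReal.ofReal (traceNorm (Φ X))

/-- The diamond norm `‖Φ‖_⋄ = sup_{k ≥ 1} ‖Φ ⊗ id_k‖₁`. -/
def diamondNorm (Φ : SuperOp m) : ENNReal :=
  ⨆ k : {k : ℕ // 1 ≤ k}, superTraceNorm (ampliate Φ k)

/-- The distance of two super-operators in the diamond norm. -/
def channelDist (Φ Ψ : SuperOp m) : ENNReal := diamondNorm (Φ - Ψ)

/-- The super-operator `X ↦ U X Uᴴ`. -/
def conjBy (U : Op m) : SuperOp m where
  toFun X := U * X * U.conjTranspose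
  map_add' X Y := by rw [mul_add, add_mul]
  map_smul' c X := by simp

/-- The set of unitary channels. -/
def unitaryChannels (m : Type) [Fintype m] [DecidableEq m] : Set (SuperOp m) :=
  {Ψ | ∃ U ∈ Matrix.unitaryGroup m ℂ, Ψ = conjBy U}

/-- The mixtures of unitary channels. -/
def mixedUnitary (m : Type) [Fintype m] [DecidableEq m] : Set (SuperOp m) :=
  convexHull ℝ (unitaryChannels m)

/-- The distance `D(Φ, Conv 𝐔) = inf { D(Φ, Ψ) : Ψ ∈ Conv 𝐔 }` of a super-operator from the
mixtures of unitary channels. -/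
def distMixedUnitary (Φ : SuperOp m) : ENNReal :=
  ⨅ Ψ : mixedUnitary m, channelDist Φ Ψ

/-- Completely positive, trace-preserving and unital super-operators. -/
structure IsUnitalChannel (Φ : SuperOp m) : Prop where
  completelyPositive : ∀ k : ℕ, 1 ≤ k → ∀ X : Op (m × Fin k),
    X.PosSemidef → (ampliate Φ k X).PosSemidef
  tracePreserving : ∀ X : Op m, (Φ X).trace = X.trace
  unital : Φ 1 = 1

/-- `Φ = ∑ₖ Eₖ · Eₖᴴ`, that is, `E` is a family of Kraus operators of `Φ`. -/
def IsKraus (Φ : SuperOp m) {r : ℕ} (E : Fin r → Op m) : Prop :=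
  ∀ X : Op m, Φ X = ∑ k, E k * X * (E k).conjTranspose

/-- The Kraus operator space `K(Φ)`: the span of the operators that occur in a Kraus
representation of `Φ`. All representations span the same space, see `krausSpace_eq_span`. -/
def krausSpace (Φ : SuperOp m) : Submodule ℂ (Op m) :=
  Submodule.span ℂ {L | ∃ (r : ℕ) (E : Fin r → Op m), IsKraus Φ E ∧ ∃ k, E k = L}

/-- `Tr (|L| - I)² / d`, where `d` is the dimension. -/
def unitaryDefect (L : Op m) : ℝ :=
  ((absOp L - 1) ^ 2).trace.re / Fintype.card m

/-- The constant `C_Φ`, the infimum of `Tr (|L| - I)² / d` over the Kraus space of `Φ`. -/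
def krausConst (Φ : SuperOp m) : ℝ := ⨅ L : krausSpace Φ, unitaryDefect (L : Op m)

/-- The Schur multiplier `X ↦ S ∘ X` (entrywise product). -/
def schurMultiplier (S : Op m) : SuperOp m where
  toFun X := Matrix.hadamard S X
  map_add' X Y := Matrix.hadamard_add S X Y
  map_smul' c X := Matrix.hadamard_smul S X c

/-- The Schur channels: `Φ_S` with `S` positive semidefinite and with unit diagonal. -/
def IsSchurChannel (Φ : SuperOp m) : Prop :=
  ∃ S : Op m, S.PosSemidef ∧ (∀ k, S k k = 1) ∧ Φ = schurMultiplier S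

/-- The tensor power `Φ^{⊗n}`, acting on the operators of `(ℂᵐ)^{⊗n}`, whose basis is indexed by
`Fin n → m`. It is the linear map with `⊗ᵢ Xᵢ ↦ ⊗ᵢ Φ(Xᵢ)`, see `tensorPower_prodOp`. -/
def tensorPower (Φ : SuperOp m) (n : ℕ) : SuperOp (Fin n → m) where
  toFun X := Matrix.of fun a b => ∑ c : Fin n → m, ∑ e : Fin n → m,
    (∏ i, Φ (Matrix.single (c i) (e i) 1) (a i) (b i)) * X c e
  map_add' X Y := by
    ext a b
    simp [mul_add, Finset.sum_add_distrib]
  map_smul' t X := by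
    ext a b
    simp only [Matrix.of_apply, Matrix.smul_apply, smul_eq_mul, RingHom.id_apply, Finset.mul_sum]
    exact Finset.sum_congr rfl fun c _ => Finset.sum_congr rfl fun e _ => by ring

/-- The operator `X₁ ⊗ ⋯ ⊗ Xₙ`. -/
def prodOp {n : ℕ} (X : Fin n → Op m) : Op (Fin n → m) :=
  Matrix.of fun a b => ∏ i, X i (a i) (b i)

/-- Matrix entries of a super-operator. -/
theorem superOp_apply (Φ : SuperOp m) (X : Op m) (a b : m) :
    Φ X a b = ∑ c, ∑ e, Φ (Matrix.single c e 1) a b * X c e := by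
  conv_lhs => rw [Matrix.matrix_eq_sum_single X]
  simp only [map_sum, Matrix.sum_apply]
  refine Finset.sum_congr rfl fun c _ => Finset.sum_congr rfl fun e _ => ?_
  have h : (Matrix.single c e (X c e) : Op m) = X c e • Matrix.single c e 1 := by
    rw [Matrix.smul_single, smul_eq_mul, mul_one]
  rw [h, map_smul, Matrix.smul_apply, smul_eq_mul, mul_comm]

theorem tensorPower_prodOp (Φ : SuperOp m) {n : ℕ} (X : Fin n → Op m) :
    tensorPower Φ n (prodOp X) = prodOp fun i => Φ (X i) := by
  ext a b
  change ∑ c : Fin n → m, ∑ e : Fin n → m,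
    (∏ i, Φ (Matrix.single (c i) (e i) 1) (a i) (b i)) * ∏ i, X i (c i) (e i)
      = ∏ i, Φ (X i) (a i) (b i)
  simp only [← Finset.prod_mul_distrib]
  have h : ∀ i, Φ (X i) (a i) (b i)
      = ∑ c, ∑ e, Φ (Matrix.single c e 1) (a i) (b i) * X i c e := fun i =>
    superOp_apply Φ (X i) (a i) (b i)
  simp only [h]
  rw [Fintype.prod_sum]
  refine Finset.sum_congr rfl fun c _ => ?_
  rw [Fintype.prod_sum]

theorem ampliate_kronecker {p : Type} (Φ : SuperOp p) (k : ℕ) (X : Op p) (Y : Op (Fin k)) :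
    ampliate Φ k (Matrix.kroneckerMap (· * ·) X Y) = Matrix.kroneckerMap (· * ·) (Φ X) Y := by
  ext a b
  change Φ (Matrix.of fun i j => X i j * Y a.2 b.2) a.1 b.1 = Φ X a.1 b.1 * Y a.2 b.2
  have h : (Matrix.of fun i j => X i j * Y a.2 b.2 : Op p) = Y a.2 b.2 • X := by
    ext i j
    simp [mul_comm]
  rw [h, map_smul, Matrix.smul_apply, smul_eq_mul, mul_comm]

theorem IsKraus.apply_single {Φ : SuperOp m} {r : ℕ} {E : Fin r → Op m} (hE : IsKraus Φ E)
    (a b c e : m) :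
    Φ (Matrix.single c e 1) a b = ∑ k, E k a c * star (E k b e) := by
  rw [hE]
  simp [Matrix.sum_apply, Matrix.mul_apply, Matrix.single_apply, ite_and]

/-- A linear functional of an operator, by matrix entries. -/
theorem functional_apply (f : Op m →ₗ[ℂ] ℂ) (X : Op m) :
    f X = ∑ a, ∑ c, f (Matrix.single a c 1) * X a c := by
  conv_lhs => rw [Matrix.matrix_eq_sum_single X]
  simp only [map_sum]
  refine Finset.sum_congr rfl fun c _ => Finset.sum_congr rfl fun e _ => ?_
  have h : (Matrix.single c e (X c e) : Op m) = X c e • Matrix.single c e 1 := by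
    rw [Matrix.smul_single, smul_eq_mul, mul_one]
  rw [h, map_smul, smul_eq_mul, mul_comm]

theorem IsKraus.sum_functional {Φ : SuperOp m} {r : ℕ} {E : Fin r → Op m} (hE : IsKraus Φ E)
    (f : Op m →ₗ[ℂ] ℂ) :
    ∑ k, f (E k) * star (f (E k)) = ∑ p : m × m, ∑ q : m × m,
      f (Matrix.single p.1 p.2 1) * star (f (Matrix.single q.1 q.2 1))
        * Φ (Matrix.single p.2 q.2 1) p.1 q.1 := by
  have hf : ∀ X : Op m, f X = ∑ p : m × m, f (Matrix.single p.1 p.2 1) * X p.1 p.2 := fun X => by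
    rw [functional_apply f X, Fintype.sum_prod_type]
  simp only [hE.apply_single, Finset.mul_sum]
  have hk : ∀ k, f (E k) * star (f (E k)) = ∑ p : m × m, ∑ q : m × m,
      f (Matrix.single p.1 p.2 1) * star (f (Matrix.single q.1 q.2 1))
        * (E k p.1 p.2 * star (E k q.1 q.2)) := fun k => by
    conv_lhs => rw [hf (E k)]
    rw [star_sum, Finset.sum_mul_sum]
    refine Finset.sum_congr rfl fun p _ => Finset.sum_congr rfl fun q _ => ?_
    rw [star_mul']
    ring
  simp only [hk]
  rw [Finset.sum_comm]
  exact Finset.sum_congr rfl fun p _ => Finset.sum_comm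

/-- The Kraus space is the span of any family of Kraus operators. -/
theorem krausSpace_eq_span {Φ : SuperOp m} {r : ℕ} {E : Fin r → Op m} (hE : IsKraus Φ E) :
    krausSpace Φ = Submodule.span ℂ (Set.range E) := by
  apply le_antisymm
  · refine Submodule.span_le.2 ?_
    rintro _ ⟨s, F, hF, k, rfl⟩
    by_contra hk
    obtain ⟨f, hfk, hf⟩ := Submodule.exists_le_ker_of_notMem hk
    have h0 : ∀ j, f (E j) = 0 := fun j => hf (Submodule.subset_span ⟨j, rfl⟩)
    have h1 : ∑ j, f (F j) * star (f (F j)) = 0 := by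
      rw [hF.sum_functional f, ← hE.sum_functional f]
      simp [h0]
    have h2 : ∑ j, Complex.normSq (f (F j)) = 0 := by
      have h3 : ((∑ j, Complex.normSq (f (F j)) : ℝ) : ℂ) = 0 := by
        rw [← h1]
        push_cast
        exact Finset.sum_congr rfl fun j _ => (Complex.mul_conj _).symm
      exact_mod_cast h3
    have h4 := (Finset.sum_eq_zero_iff_of_nonneg fun j _ => Complex.normSq_nonneg _).1 h2 k
      (Finset.mem_univ k)
    exact hfk (Complex.normSq_eq_zero.1 h4)
  · refine Submodule.span_le.2 ?_
    rintro _ ⟨k, rfl⟩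
    exact Submodule.subset_span ⟨r, E, hE, k, rfl⟩

end Basic

end SchurAQBC

end

noncomputable section

namespace SchurAQBC

open Matrix
open scoped ComplexOrder MatrixOrder

set_option linter.unusedSectionVars false

variable {m : Type} [Fintype m] [DecidableEq m]

/-! ### Absolute values and the trace norm -/

/-! A Schur channel has diagonal Kraus operators, and `diagonal l` lies in its Kraus space whenever
`l` lies in the range of `S`. The defect of `diagonal l` is the mean of `(|l i| - 1)²`, so every
vector in the range of `S` is at squared distance at least `d C` from the vectors with unimodular
entries.

Let `T = S^{⊗n}`, `N = d ^ n`, and let `P` be the projection onto the range of `T`. Apply a channel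
to half of a maximally entangled state and test the output with `P`, placed on the span of the `|i⟩
⊗ |i⟩`. Up to the factor `1 / N`, the Schur channel of `T` gives `Tr P T = Tr T = N`. A unitary `U`
gives `⟨w, P w⟩`, where `w` is its diagonal and has entries of modulus at most one. This is at most
`N - N C` by `dotProduct_proj_re_le`, and linearity extends the bound to mixtures, leaving a gap
`C`.

The constant survives tensor powers because a vector in the range of `S^{⊗(n+1)}` splits into `d ^
n` slices in the range of `S`, each contributing at least `d C` (`le_sum_prodOp_mulVec`). -/

theorem absOp_posSemidef (X : Op m) : (absOp X).PosSemidef :=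
  nonneg_iff_posSemidef.1 (CFC.abs_nonneg X)

theorem absOp_sub_self_posSemidef {X : Op m} (hX : X.IsHermitian) :
    (absOp X - X).PosSemidef := by
  have h : absOp X - X = 2 • X⁻ := CFC.abs_sub_self X hX.isSelfAdjoint
  rw [h]
  exact nonneg_iff_posSemidef.1 (nsmul_nonneg (CFC.negPart_nonneg X) 2)

theorem traceNorm_of_posSemidef {X : Op m} (hX : X.PosSemidef) : traceNorm X = X.trace.re := by
  have h : absOp X = X := CFC.abs_of_nonneg X (nonneg_iff_posSemidef.2 hX)
  rw [traceNorm, h]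

theorem absOp_diagonal (l : m → ℂ) : absOp (diagonal l) = diagonal fun i => (‖l i‖ : ℂ) := by
  have hpos : (0 : Op m) ≤ diagonal fun i => (‖l i‖ : ℂ) :=
    nonneg_iff_posSemidef.2 (posSemidef_diagonal_iff.2 fun i => by
      exact_mod_cast norm_nonneg (l i))
  refine CFC.sqrt_unique ?_ hpos
  rw [star_eq_conjTranspose, diagonal_conjTranspose, diagonal_mul_diagonal, diagonal_mul_diagonal]
  congr 1
  ext i
  rw [Pi.star_apply, ← starRingEnd_apply, Complex.conj_mul', sq]

theorem unitaryDefect_diagonal (l : m → ℂ) :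
    unitaryDefect (diagonal l) = (∑ i, (‖l i‖ - 1) ^ 2) / Fintype.card m := by
  have h : (absOp (diagonal l) - 1) ^ 2 = diagonal fun i => (((‖l i‖ - 1) ^ 2 : ℝ) : ℂ) := by
    rw [absOp_diagonal, ← diagonal_one, diagonal_sub, sq, diagonal_mul_diagonal]
    congr 1
    ext i
    push_cast
    ring
  rw [unitaryDefect, h, trace_diagonal, ← Complex.ofReal_sum, Complex.ofReal_re]

/-- Compressing a positive operator to a subspace does not increase its trace. -/
theorem trace_proj_mul_re_nonneg {P M : Op m} (hP : P.IsHermitian) (hPP : P * P = P)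
    (hM : M.PosSemidef) : 0 ≤ (P * M).trace.re := by
  have h : (P * M).trace = (P * M * Pᴴ).trace := by
    rw [trace_mul_comm (P * M), hP.eq, ← mul_assoc, hPP]
  rw [h]
  exact (Complex.nonneg_iff.1 (hM.mul_mul_conjTranspose_same P).trace_nonneg).1

theorem trace_proj_mul_re_le {P M : Op m} (hP : P.IsHermitian) (hPP : P * P = P)
    (hM : M.PosSemidef) : (P * M).trace.re ≤ M.trace.re := by
  have h := trace_proj_mul_re_nonneg (P := 1 - P) (isHermitian_one.sub hP)
    (by simp [mul_sub, sub_mul, hPP]) hM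
  rw [sub_mul, one_mul, trace_sub, Complex.sub_re] at h
  linarith

theorem trace_submatrix_re_le {p : Type} [Fintype p] {M : Op p} (hM : M.PosSemidef) {f : m → p}
    (hf : Function.Injective f) : (M.submatrix f f).trace.re ≤ M.trace.re := by
  classical
  simp only [trace, Complex.re_sum, diag_apply, submatrix_apply]
  rw [← Finset.sum_image (f := fun a => (M a a).re) (g := f) hf.injOn]
  exact Finset.sum_le_sum_of_subset_of_nonneg (Finset.subset_univ _)
    fun a _ _ => (Complex.nonneg_iff.1 hM.diag_nonneg).1

/-- A projection supported on the basis vectors in the range of `f` is a test operator for the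
trace norm. -/
theorem trace_proj_mul_submatrix_le_traceNorm {p : Type} [Fintype p] [DecidableEq p] {P : Op m}
    (hP : P.IsHermitian) (hPP : P * P = P) {Y : Op p} (hY : Y.IsHermitian) {f : m → p}
    (hf : Function.Injective f) : (P * Y.submatrix f f).trace.re ≤ traceNorm Y := by
  have h1 := trace_proj_mul_re_nonneg hP hPP ((absOp_sub_self_posSemidef hY).submatrix f)
  -- With `Z_f` the compression of `Z` along `f`: `Tr P Y_f ≤ Tr P |Y|_f ≤ Tr |Y|_f ≤ Tr |Y|`.
  have h2 := trace_proj_mul_re_le hP hPP ((absOp_posSemidef Y).submatrix f)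
  have h3 := trace_submatrix_re_le (absOp_posSemidef Y) hf
  rw [submatrix_sub, Pi.sub_apply, Pi.sub_apply, mul_sub, trace_sub, Complex.sub_re] at h1
  exact (sub_nonneg.1 h1).trans (h2.trans h3)

/-- The orthogonal projection onto the range of a Hermitian operator. -/
theorem exists_rangeProj {T : Op m} (hT : T.IsHermitian) :
    ∃ P G : Op m, P.IsHermitian ∧ P * P = P ∧ P * T = T ∧ P = T * G := by
  set D : Op m := diagonal (RCLike.ofReal ∘ hT.eigenvalues) with hD
  set φ := Unitary.conjStarAlgAut ℂ (Op m) hT.eigenvectorUnitary with hφ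
  set Q : Op m := diagonal fun i => if hT.eigenvalues i = 0 then 0 else 1 with hQ
  -- Since `0⁻¹ = 0`, this is the pseudo-inverse of `D`, and `D * R = Q`.
  set R : Op m := diagonal fun i => ((hT.eigenvalues i : ℂ))⁻¹ with hR
  have hTφ : T = φ D := hT.spectral_theorem
  refine ⟨φ Q, φ R, ?_, ?_, ?_, ?_⟩
  · rw [IsHermitian, ← star_eq_conjTranspose, ← map_star, star_eq_conjTranspose, hQ,
      diagonal_conjTranspose]
    congr 2
    ext i
    by_cases h : hT.eigenvalues i = 0 <;> simp [h]
  · rw [← map_mul, hQ, diagonal_mul_diagonal]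
    simp
  · conv_lhs => rw [hTφ]
    conv_rhs => rw [hTφ]
    rw [← map_mul, hQ, hD, diagonal_mul_diagonal]
    congr 2
    ext i
    by_cases h : hT.eigenvalues i = 0 <;> simp [h]
  · conv_rhs => rw [hTφ]
    rw [← map_mul, hR, hD, hQ, diagonal_mul_diagonal]
    congr 2
    ext i
    by_cases h : hT.eigenvalues i = 0 <;> simp [h]

/-! ### Testing super-operators on the maximally entangled state -/

/-- The pairing of a super-operator `Ψ` with the operator `P` on the span of the vectors
`|i⟩ ⊗ |i⟩`, through the unnormalized Choi operator of `Ψ`. -/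
def choiPairing (P : Op m) (Ψ : SuperOp m) : ℂ :=
  ∑ i, ∑ j, P i j * Ψ (single j i 1) j i

/-- The super-operators that commute with the adjoint. -/
def IsStarPreserving (Ψ : SuperOp m) : Prop := ∀ X : Op m, Ψ Xᴴ = (Ψ X)ᴴ

theorem IsStarPreserving.ampliate_isHermitian {Ψ : SuperOp m} (h : IsStarPreserving Ψ) {k : ℕ}
    {X : Op (m × Fin k)} (hX : X.IsHermitian) : (ampliate Ψ k X).IsHermitian := by
  refine IsHermitian.ext fun a b => ?_
  have h1 : (of fun i j => X (i, a.2) (j, b.2) : Op m)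
      = (of fun i j => X (i, b.2) (j, a.2) : Op m)ᴴ := by
    ext i j
    simp [hX.apply]
  change star (Ψ (of fun i j => X (i, b.2) (j, a.2)) b.1 a.1)
    = Ψ (of fun i j => X (i, a.2) (j, b.2)) a.1 b.1
  rw [h1, h, conjTranspose_apply]

/-- The maximally entangled state, where `e` identifies the two tensor factors. -/
def maxEntangled {k : ℕ} (e : m ≃ Fin k) : Op (m × Fin k) :=
  (Fintype.card m : ℂ)⁻¹ • vecMulVec (fun a => if a.2 = e a.1 then 1 else 0)
    (star fun a => if a.2 = e a.1 then 1 else 0)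

theorem maxEntangled_posSemidef {k : ℕ} (e : m ≃ Fin k) : (maxEntangled e).PosSemidef :=
  (posSemidef_vecMulVec_self_star _).smul (by
    rw [← Complex.ofReal_natCast, ← Complex.ofReal_inv]
    exact_mod_cast inv_nonneg.2 (Nat.cast_nonneg _))

theorem trace_maxEntangled [Nonempty m] {k : ℕ} (e : m ≃ Fin k) : (maxEntangled e).trace = 1 := by
  simp [maxEntangled, trace_vecMulVec, dotProduct, Fintype.sum_prod_type]

theorem ampliate_maxEntangled (Ψ : SuperOp m) {k : ℕ} (e : m ≃ Fin k) (i j : m) :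
    ampliate Ψ k (maxEntangled e) (i, e i) (j, e j)
      = (Fintype.card m : ℂ)⁻¹ * Ψ (single i j 1) i j := by
  have h : (of fun x y => maxEntangled e (x, e i) (y, e j) : Op m)
      = (Fintype.card m : ℂ)⁻¹ • single i j 1 := by
    ext x y
    simp [maxEntangled, vecMulVec_apply, single_apply, ite_and]
    by_cases hx : i = x <;> by_cases hy : j = y <;> simp [hx, hy]
  change Ψ (of fun x y => maxEntangled e (x, e i) (y, e j)) i j = _
  rw [h, map_smul, Matrix.smul_apply, smul_eq_mul]

/-- The maximally entangled state competes in the supremum with an ancilla of the same dimension.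
Its normalization produces the division by the dimension, and star preservation makes the output
Hermitian, so that `P` can test it. -/
theorem choiPairing_le_diamondNorm [Nonempty m] {P : Op m} (hP : P.IsHermitian) (hPP : P * P = P)
    {Ψ : SuperOp m} (hΨ : IsStarPreserving Ψ) :
    ENNReal.ofReal ((choiPairing P Ψ).re / Fintype.card m) ≤ diamondNorm Ψ := by
  let e := Fintype.equivFin m
  have hX : traceNorm (maxEntangled e) ≤ 1 := by
    rw [traceNorm_of_posSemidef (maxEntangled_posSemidef e), trace_maxEntangled, Complex.one_re]
  refine le_trans (ENNReal.ofReal_le_ofReal ?_)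
    (le_trans (le_iSup (fun X : {X : Op (m × Fin (Fintype.card m)) // traceNorm X ≤ 1} =>
      ENNReal.ofReal (traceNorm (ampliate Ψ (Fintype.card m) X))) ⟨maxEntangled e, hX⟩)
      (le_iSup (fun k : {k : ℕ // 1 ≤ k} => superTraceNorm (ampliate Ψ k))
        ⟨Fintype.card m, Fintype.card_pos⟩))
  have hf : Function.Injective fun i => (i, e i) := fun i j h => (Prod.ext_iff.1 h).1
  have h := trace_proj_mul_submatrix_le_traceNorm hP hPP
    (hΨ.ampliate_isHermitian (maxEntangled_posSemidef e).isHermitian) hf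
  refine le_trans (le_of_eq ?_) h
  have h1 : (P * (ampliate Ψ (Fintype.card m) (maxEntangled e)).submatrix (fun i => (i, e i))
      fun i => (i, e i)).trace = ((Fintype.card m : ℝ)⁻¹ : ℝ) * choiPairing P Ψ := by
    simp only [trace, diag_apply, mul_apply, submatrix_apply, ampliate_maxEntangled, choiPairing,
      Finset.mul_sum]
    refine Finset.sum_congr rfl fun i _ => Finset.sum_congr rfl fun j _ => ?_
    push_cast
    ring
  rw [h1, Complex.re_ofReal_mul, div_eq_inv_mul]

theorem conjBy_isStarPreserving (U : Op m) : IsStarPreserving (conjBy U) := fun X => by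
  change U * Xᴴ * Uᴴ = (U * X * Uᴴ)ᴴ
  simp [mul_assoc]

/-- The test sees only the diagonal of `U`, which reduces the problem to vectors. -/
theorem choiPairing_conjBy (P U : Op m) :
    choiPairing P (conjBy U) = star U.diag ⬝ᵥ P *ᵥ U.diag := by
  have h : ∀ i j, conjBy U (single j i 1) j i = U j j * star (U i i) := fun i j => by
    change (U * single j i (1 : ℂ) * Uᴴ : Op m) j i = _
    simp [mul_apply, single_apply, ite_and]
  simp only [choiPairing, h, dotProduct, mulVec, Finset.mul_sum]
  refine Finset.sum_congr rfl fun i _ => Finset.sum_congr rfl fun j _ => ?_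
  simp only [Pi.star_apply, diag_apply]
  ring

theorem norm_diag_unitary_le_one {U : Op m} (hU : U ∈ unitaryGroup m ℂ) (i : m) :
    ‖U i i‖ ≤ 1 := entry_norm_bound_of_unitary hU i i

/-- If the projection `P` keeps every vector at distance from the vectors of unimodular entries,
then it is badly correlated with the vectors of entries of modulus at most one. -/
theorem dotProduct_proj_re_le {P : Op m} (hP : P.IsHermitian) (hPP : P * P = P) {w : m → ℂ}
    (hw : ∀ i, ‖w i‖ ≤ 1) {c : ℝ} (hc : c ≤ ∑ i, (‖(P *ᵥ w) i‖ - 1) ^ 2) :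
    (star w ⬝ᵥ P *ᵥ w).re ≤ Fintype.card m - c := by
  set l := P *ᵥ w with hl
  -- As `P` is a projection, `‖l‖² = ⟨w, l⟩ ≤ ∑ |l i|`. Hence `∑ (|l i| - 1)² ≤ N - ‖l‖²`, where `N`
  -- is the dimension.
  have h1 : (star w ⬝ᵥ l) = star l ⬝ᵥ l := by
    conv_rhs => rw [hl, star_mulVec, hP.eq, dotProduct_mulVec, vecMul_vecMul, hPP,
      ← dotProduct_mulVec]
  have h2 : (star l ⬝ᵥ l).re = ∑ i, ‖l i‖ ^ 2 := by
    simp only [dotProduct, Complex.re_sum, Pi.star_apply]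
    refine Finset.sum_congr rfl fun i _ => ?_
    rw [← starRingEnd_apply, Complex.conj_mul', ← Complex.ofReal_pow, Complex.ofReal_re]
  have h3 : (star w ⬝ᵥ l).re ≤ ∑ i, ‖l i‖ := by
    simp only [dotProduct, Complex.re_sum]
    refine Finset.sum_le_sum fun i _ => (Complex.re_le_norm _).trans ?_
    rw [norm_mul, Pi.star_apply, norm_star]
    exact mul_le_of_le_one_left (norm_nonneg _) (hw i)
  have h4 : ∑ i, (‖l i‖ - 1) ^ 2 = ∑ i, ‖l i‖ ^ 2 - 2 * ∑ i, ‖l i‖ + Fintype.card m := by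
    have h5 : ∀ i, (‖l i‖ - 1) ^ 2 = ‖l i‖ ^ 2 - 2 * ‖l i‖ + 1 := fun i => by ring
    simp only [h5, Finset.sum_add_distrib, Finset.sum_sub_distrib, ← Finset.mul_sum,
      Finset.sum_const, Finset.card_univ, nsmul_eq_mul, mul_one]
  rw [h1] at h3 ⊢
  rw [h2] at h3 ⊢
  linarith

/-- A bound on the pairing with unitary channels extends to their mixtures. -/
theorem mixedUnitary_choiPairing_le {P : Op m} {c : ℝ}
    (hc : ∀ U ∈ unitaryGroup m ℂ, (choiPairing P (conjBy U)).re ≤ c) {Ψ : SuperOp m}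
    (hΨ : Ψ ∈ mixedUnitary m) : IsStarPreserving Ψ ∧ (choiPairing P Ψ).re ≤ c := by
  -- Star preservation is carried along because the diamond norm test needs it for the difference of
  -- the channels.
  refine convexHull_min (t := {Ψ | IsStarPreserving Ψ ∧ (choiPairing P Ψ).re ≤ c}) ?_ ?_ hΨ
  · rintro _ ⟨U, hU, rfl⟩
    exact ⟨conjBy_isStarPreserving U, hc U hU⟩
  · rintro Ψ₁ ⟨h₁, h₁'⟩ Ψ₂ ⟨h₂, h₂'⟩ a b ha hb hab
    refine ⟨fun X => ?_, ?_⟩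
    · simp [h₁ X, h₂ X]
    · have h : choiPairing P (a • Ψ₁ + b • Ψ₂)
          = (a : ℂ) * choiPairing P Ψ₁ + (b : ℂ) * choiPairing P Ψ₂ := by
        simp only [choiPairing, Finset.mul_sum, ← Finset.sum_add_distrib]
        refine Finset.sum_congr rfl fun i _ => Finset.sum_congr rfl fun j _ => ?_
        simp only [LinearMap.add_apply, LinearMap.smul_apply, Matrix.add_apply, Matrix.smul_apply,
          Complex.real_smul]
        ring
      rw [h, Complex.add_re, Complex.re_ofReal_mul, Complex.re_ofReal_mul]
      calc _ ≤ a * c + b * c := by gcongr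
        _ = c := by rw [← add_mul, hab, one_mul]

/-! ### Schur multipliers -/

theorem schurMultiplier_isStarPreserving {T : Op m} (hT : T.IsHermitian) :
    IsStarPreserving (schurMultiplier T) := fun X => by
  ext i j
  change T i j * Xᴴ i j = star (T j i * X j i)
  rw [star_mul', hT.apply, conjTranspose_apply]

theorem choiPairing_schurMultiplier (P T : Op m) :
    choiPairing P (schurMultiplier T) = (P * T).trace := by
  simp only [choiPairing, trace, diag_apply, mul_apply]
  refine Finset.sum_congr rfl fun i _ => Finset.sum_congr rfl fun j _ => ?_
  change P i j * (T j i * single j i (1 : ℂ) j i) = _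
  rw [single_apply_same, mul_one]

theorem le_distMixedUnitary_schurMultiplier [Nonempty m] {T : Op m} (hT : T.IsHermitian)
    (hT1 : ∀ i, T i i = 1) {c : ℝ}
    (hc : ∀ v : m → ℂ, Fintype.card m * c ≤ ∑ i, (‖(T *ᵥ v) i‖ - 1) ^ 2) :
    ENNReal.ofReal c ≤ distMixedUnitary (schurMultiplier T) := by
  obtain ⟨P, G, hP, hPP, hPT, hPG⟩ := exists_rangeProj hT
  have hU : ∀ U ∈ unitaryGroup m ℂ,
      (choiPairing P (conjBy U)).re ≤ Fintype.card m - Fintype.card m * c := fun U hU => by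
    rw [choiPairing_conjBy]
    refine dotProduct_proj_re_le hP hPP (norm_diag_unitary_le_one hU) ?_
    -- `P w = T (G w)` lies in the range of `T`, where `hc` applies.
    have h := hc (G *ᵥ U.diag)
    rwa [mulVec_mulVec, ← hPG] at h
  refine le_iInf fun Ψ => ?_
  obtain ⟨hΨ, hΨc⟩ := mixedUnitary_choiPairing_le hU Ψ.2
  have hstar : IsStarPreserving (schurMultiplier T - (Ψ : SuperOp m)) := fun X => by
    simp [schurMultiplier_isStarPreserving hT X, hΨ X]
  refine le_trans (ENNReal.ofReal_le_ofReal ?_) (choiPairing_le_diamondNorm hP hPP hstar)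
  have hsub : choiPairing P (schurMultiplier T - (Ψ : SuperOp m))
      = Fintype.card m - choiPairing P Ψ := by
    have h : choiPairing P (schurMultiplier T) = Fintype.card m := by
      simp [choiPairing_schurMultiplier, hPT, trace, hT1]
    rw [← h]
    simp only [choiPairing, LinearMap.sub_apply, Matrix.sub_apply, mul_sub, Finset.sum_sub_distrib]
  have hcard : (0 : ℝ) < Fintype.card m := by exact_mod_cast Fintype.card_pos
  rw [hsub, le_div_iff₀ hcard, Complex.sub_re, Complex.natCast_re]
  linarith

/-- Every matrix unit is mapped to a multiple of itself, so only the term `c = a`, `e = b` survives.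
-/
theorem tensorPower_schurMultiplier (S : Op m) (n : ℕ) :
    tensorPower (schurMultiplier S) n = schurMultiplier (prodOp fun _ : Fin n => S) := by
  refine LinearMap.ext fun X => ?_
  ext a b
  change ∑ c : Fin n → m, ∑ e : Fin n → m,
    (∏ i, S (a i) (b i) * single (c i) (e i) (1 : ℂ) (a i) (b i)) * X c e
      = (∏ i, S (a i) (b i)) * X a b
  rw [Finset.sum_eq_single a, Finset.sum_eq_single b]
  · simp
  · intro e _ he
    obtain ⟨i, hi⟩ := Function.ne_iff.1 he
    rw [Finset.prod_eq_zero (Finset.mem_univ i), zero_mul]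
    rw [single_apply_of_col_ne _ _ hi, mul_zero]
  · simp
  · intro c _ hc
    obtain ⟨i, hi⟩ := Function.ne_iff.1 hc
    refine Finset.sum_eq_zero fun e _ => ?_
    rw [Finset.prod_eq_zero (Finset.mem_univ i), zero_mul]
    rw [single_apply_of_row_ne hi, mul_zero]
  · simp

/-- The slices along the first factor of a vector in the range of `S^{⊗(n+1)}` lie in the range
of `S`. -/
theorem exists_prodOp_mulVec_cons (S : Op m) {n : ℕ} (v : (Fin (n + 1) → m) → ℂ)
    (r : Fin n → m) : ∃ x : m → ℂ, ∀ a,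
      ((prodOp fun _ => S) *ᵥ v) (Fin.cons a r : Fin (n + 1) → m) = (S *ᵥ x) a := by
  -- Contract the last `n` factors of `v` with the row `r` of `S^{⊗n}`; the first factor still has
  -- to be multiplied by `S`.
  refine ⟨fun b => ∑ t : Fin n → m, (∏ i, S (r i) (t i)) * v (Fin.cons b t : Fin (n + 1) → m),
    fun a => ?_⟩
  simp only [mulVec, dotProduct, prodOp, of_apply]
  rw [← (Fin.consEquiv fun _ => m).sum_comp, Fintype.sum_prod_type]
  refine Finset.sum_congr rfl fun b _ => ?_
  rw [Finset.mul_sum]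
  refine Finset.sum_congr rfl fun t _ => ?_
  simp [Fin.consEquiv, Fin.prod_univ_succ, mul_assoc]

theorem le_sum_prodOp_mulVec {S : Op m} {c : ℝ}
    (hc : ∀ v : m → ℂ, Fintype.card m * c ≤ ∑ i, (‖(S *ᵥ v) i‖ - 1) ^ 2) (n : ℕ)
    (v : (Fin (n + 1) → m) → ℂ) :
    Fintype.card (Fin (n + 1) → m) * c
      ≤ ∑ a, (‖((prodOp fun _ : Fin (n + 1) => S) *ᵥ v) a‖ - 1) ^ 2 := by
  have h : ∀ r : Fin n → m, Fintype.card m * c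
      ≤ ∑ a, (‖((prodOp fun _ => S) *ᵥ v) (Fin.cons a r : Fin (n + 1) → m)‖ - 1) ^ 2 := fun r => by
    obtain ⟨x, hx⟩ := exists_prodOp_mulVec_cons S v r
    simpa only [hx] using hc x
  rw [← (Fin.consEquiv fun _ => m).sum_comp, Fintype.sum_prod_type, Finset.sum_comm]
  refine le_trans (le_of_eq ?_) (Finset.sum_le_sum fun r _ => h r)
  simp
  ring

theorem prodOp_isHermitian {n : ℕ} {S : Op m} (hS : S.IsHermitian) :
    (prodOp fun _ : Fin n => S).IsHermitian := by
  refine IsHermitian.ext fun a b => ?_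
  simp only [prodOp, of_apply]
  rw [← starRingEnd_apply, map_prod]
  exact Finset.prod_congr rfl fun i _ => hS.apply _ _

theorem schurMultiplier_isUnitalChannel {S : Op m} (hS : S.PosSemidef) (hS1 : ∀ i, S i i = 1) :
    IsUnitalChannel (schurMultiplier S) where
  -- The ampliation is the entrywise product with `S ⊗ J`, `J` the all-ones matrix; the Schur
  -- product theorem applies.
  completelyPositive k _ X hX := (hS.submatrix (Prod.fst : m × Fin k → m)).hadamard hX
  tracePreserving X := by
    change ∑ i, S i i * X i i = ∑ i, X i i
    simp only [hS1, one_mul]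
  unital := by
    ext i j
    change S i j * (1 : Op m) i j = (1 : Op m) i j
    by_cases h : i = j
    · rw [h, hS1, one_mul]
    · rw [one_apply_ne h, mul_zero]

/-! ### The Kraus space of a Schur multiplier -/

/-- The diagonal Kraus operators of the Schur multiplier of `Bᴴ B`. -/
theorem isKraus_schurMultiplier {d : ℕ} (B : Op (Fin d)) :
    IsKraus (schurMultiplier (Bᴴ * B)) fun k => diagonal fun i => star (B k i) := fun X => by
  ext i j
  change (∑ k, star (B k i) * B k j) * X i j = _
  rw [Matrix.sum_apply, Finset.sum_mul]
  refine Finset.sum_congr rfl fun k _ => ?_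
  rw [diagonal_conjTranspose, mul_diagonal, diagonal_mul, Pi.star_apply, star_star]
  ring

/-- For `S = Bᴴ B`, the Kraus operators carry the columns of `Bᴴ` on their diagonals, and `S v = Bᴴ
(B v)` combines these columns. -/
theorem diagonal_mulVec_mem_krausSpace {d : ℕ} {S : Op (Fin d)} (hS : S.PosSemidef)
    (v : Fin d → ℂ) : diagonal (S *ᵥ v) ∈ krausSpace (schurMultiplier S) := by
  obtain ⟨B, rfl⟩ := CStarAlgebra.nonneg_iff_eq_star_mul_self.1 (nonneg_iff_posSemidef.2 hS)
  rw [star_eq_conjTranspose, krausSpace_eq_span (isKraus_schurMultiplier B)]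
  have h : diagonal ((Bᴴ * B) *ᵥ v)
      = ∑ k, (B *ᵥ v) k • (diagonal fun i => star (B k i) : Op (Fin d)) := by
    ext i j
    rw [Matrix.sum_apply, ← mulVec_mulVec]
    by_cases hij : i = j
    · subst hij
      simp only [diagonal_apply_eq, Matrix.smul_apply, smul_eq_mul]
      change ∑ k, star (B k i) * (B *ᵥ v) k = _
      exact Finset.sum_congr rfl fun k _ => mul_comm (star (B k i)) ((B *ᵥ v) k)
    · simp [diagonal_apply_ne _ hij]
  rw [h]
  exact Submodule.sum_mem _ fun k _ => Submodule.smul_mem _ _ (Submodule.subset_span ⟨k, rfl⟩)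

theorem exists_eq_diagonal_of_mem_krausSpace {d : ℕ} {S : Op (Fin d)} (hS : S.PosSemidef)
    {L : Op (Fin d)} (hL : L ∈ krausSpace (schurMultiplier S)) :
    ∃ l : Fin d → ℂ, L = diagonal l := by
  obtain ⟨B, rfl⟩ := CStarAlgebra.nonneg_iff_eq_star_mul_self.1 (nonneg_iff_posSemidef.2 hS)
  rw [star_eq_conjTranspose, krausSpace_eq_span (isKraus_schurMultiplier B)] at hL
  have h : Submodule.span ℂ (Set.range fun k => (diagonal fun i => star (B k i) : Op (Fin d)))
      ≤ LinearMap.range (diagonalLinearMap (Fin d) ℂ ℂ) := by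
    rw [Submodule.span_le]
    rintro _ ⟨k, rfl⟩
    exact ⟨fun i => star (B k i), rfl⟩
  obtain ⟨l, hl⟩ := h hL
  exact ⟨l, hl.symm⟩

/-- On a space of diagonal operators the infimum of `Tr (|L| - 1)² / d` is attained. -/
theorem exists_min_unitaryDefect [Nonempty m] (K : Submodule ℂ (Op m))
    (hK : ∀ L ∈ K, ∃ l : m → ℂ, L = diagonal l) :
    ∃ L ∈ K, ∀ M ∈ K, unitaryDefect L ≤ unitaryDefect M := by
  let V : Submodule ℂ (m → ℂ) := K.comap (diagonalLinearMap m ℂ ℂ)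
  let f : (m → ℂ) → ℝ := fun l => ∑ i, (‖l i‖ - 1) ^ 2
  have hf : Continuous f := by fun_prop
  let N : ℝ := Fintype.card m
  have hN : 1 ≤ N := Nat.one_le_cast.2 Fintype.card_pos
  -- Outside the sup-norm ball of radius `N + 1` some entry exceeds `N + 1` in modulus and alone
  -- contributes more than `N² ≥ N = f 0`, so minimizing inside the ball suffices.
  have hcpt : IsCompact ((V : Set (m → ℂ)) ∩ Metric.closedBall 0 (N + 1)) :=
    (isCompact_closedBall _ _).inter_left V.closed_of_finiteDimensional
  obtain ⟨l, hl, hmin⟩ := hcpt.exists_isMinOn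
    ⟨0, V.zero_mem, Metric.mem_closedBall_self (by linarith)⟩ hf.continuousOn
  have hf0 : f 0 = N := by simp [f, N]
  refine ⟨diagonal l, hl.1, fun M hM => ?_⟩
  obtain ⟨k, rfl⟩ := hK M hM
  rw [unitaryDefect_diagonal, unitaryDefect_diagonal]
  refine div_le_div_of_nonneg_right ?_ (Nat.cast_nonneg _)
  by_cases hk : k ∈ Metric.closedBall (0 : m → ℂ) (N + 1)
  · exact hmin ⟨hM, hk⟩
  · have h0 : f l ≤ f 0 := hmin ⟨V.zero_mem, Metric.mem_closedBall_self (by linarith)⟩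
    refine h0.trans ?_
    rw [hf0]
    rw [mem_closedBall_zero_iff, pi_norm_le_iff_of_nonneg (by linarith)] at hk
    push Not at hk
    obtain ⟨i, hi⟩ := hk
    calc N ≤ (‖k i‖ - 1) ^ 2 := by nlinarith
      _ ≤ f k := Finset.single_le_sum (f := fun i => (‖k i‖ - 1) ^ 2)
        (fun i _ => sq_nonneg _) (Finset.mem_univ i)

theorem diagonal_mem_unitaryGroup_of_defect_eq_zero [Nonempty m] {l : m → ℂ}
    (h : unitaryDefect (diagonal l) = 0) : diagonal l ∈ unitaryGroup m ℂ := by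
  have hcard : (Fintype.card m : ℝ) ≠ 0 := by exact_mod_cast Fintype.card_ne_zero
  rw [unitaryDefect_diagonal, div_eq_zero_iff, or_iff_left hcard,
    Finset.sum_eq_zero_iff_of_nonneg fun i _ => sq_nonneg _] at h
  rw [mem_unitaryGroup_iff', star_eq_conjTranspose, diagonal_conjTranspose, diagonal_mul_diagonal,
    ← diagonal_one]
  congr 1
  ext i
  have hi : ‖l i‖ = 1 := sub_eq_zero.1 (pow_eq_zero_iff two_ne_zero |>.1 (h i (Finset.mem_univ i)))
  rw [Pi.star_apply, ← starRingEnd_apply, Complex.conj_mul', hi]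
  simp

end SchurAQBC

end

theorem corollary1 (d : ℕ) (Φ : SchurAQBC.SuperOp (Fin d))
    (hΦ : SchurAQBC.IsSchurChannel Φ)
    (hK : (SchurAQBC.krausSpace Φ : Set (SchurAQBC.Op (Fin d)))
      ∩ (Matrix.unitaryGroup (Fin d) ℂ : Set (SchurAQBC.Op (Fin d))) = ∅) :
    (∃ L ∈ SchurAQBC.krausSpace Φ, SchurAQBC.unitaryDefect L = SchurAQBC.krausConst Φ) ∧
    0 < SchurAQBC.krausConst Φ ∧
    (∀ n : ℕ, 1 ≤ n → ENNReal.ofReal (SchurAQBC.krausConst Φ)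
      ≤ SchurAQBC.distMixedUnitary (SchurAQBC.tensorPower Φ n)) ∧
    SchurAQBC.IsUnitalChannel Φ ∧
    ¬ Filter.Tendsto (fun n : ℕ => SchurAQBC.distMixedUnitary (SchurAQBC.tensorPower Φ n))
      Filter.atTop (nhds 0) := by
  obtain ⟨S, hS, hS1, rfl⟩ := hΦ
  obtain rfl | hd := Nat.eq_zero_or_pos d
  -- In dimension zero the zero operator is the identity, hence unitary, against `hK`.
  · refine absurd hK (Set.Nonempty.ne_empty ⟨0, Submodule.zero_mem _, ?_⟩)
    rw [Subsingleton.elim (0 : SchurAQBC.Op (Fin 0)) 1]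
    exact one_mem (Matrix.unitaryGroup (Fin 0) ℂ)
  have : Nonempty (Fin d) := ⟨⟨0, hd⟩⟩
  obtain ⟨L, hL, hmin⟩ := SchurAQBC.exists_min_unitaryDefect _
    fun _ => SchurAQBC.exists_eq_diagonal_of_mem_krausSpace hS
  have hC : SchurAQBC.unitaryDefect L = SchurAQBC.krausConst (SchurAQBC.schurMultiplier S) :=
    le_antisymm (le_ciInf fun M => hmin M M.2)
      (ciInf_le ⟨SchurAQBC.unitaryDefect L, by rintro _ ⟨M, rfl⟩; exact hmin M M.2⟩
        (⟨L, hL⟩ : SchurAQBC.krausSpace (SchurAQBC.schurMultiplier S)))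
  rw [← hC]
  have hpos : 0 < SchurAQBC.unitaryDefect L := by
    obtain ⟨l, rfl⟩ := SchurAQBC.exists_eq_diagonal_of_mem_krausSpace hS hL
    refine lt_of_le_of_ne ?_ fun h => Set.eq_empty_iff_forall_notMem.1 hK _
      ⟨hL, SchurAQBC.diagonal_mem_unitaryGroup_of_defect_eq_zero h.symm⟩
    rw [SchurAQBC.unitaryDefect_diagonal]
    positivity
  have hslice : ∀ v : Fin d → ℂ, Fintype.card (Fin d) * SchurAQBC.unitaryDefect L
      ≤ ∑ i, (‖(S.mulVec v) i‖ - 1) ^ 2 := fun v => by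
    have h := hmin _ (SchurAQBC.diagonal_mulVec_mem_krausSpace hS v)
    rwa [SchurAQBC.unitaryDefect_diagonal (S.mulVec v), le_div_iff₀' (by simpa using hd)] at h
  have hbound : ∀ n : ℕ, 1 ≤ n → ENNReal.ofReal (SchurAQBC.unitaryDefect L)
      ≤ SchurAQBC.distMixedUnitary (SchurAQBC.tensorPower (SchurAQBC.schurMultiplier S) n) := by
    rintro (_ | n) hn
    · simp at hn
    · rw [SchurAQBC.tensorPower_schurMultiplier]
      exact SchurAQBC.le_distMixedUnitary_schurMultiplier
        (SchurAQBC.prodOp_isHermitian hS.1) (fun a => by simp [SchurAQBC.prodOp, hS1])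
        (SchurAQBC.le_sum_prodOp_mulVec hslice n)
  refine ⟨⟨L, hL, rfl⟩, hpos, hbound, SchurAQBC.schurMultiplier_isUnitalChannel hS hS1,
    fun hlim => ?_⟩
  exact (ENNReal.ofReal_pos.2 hpos).not_ge
    (ge_of_tendsto hlim (Filter.eventually_atTop.2 ⟨1, hbound⟩))
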